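/- Call a natural number $N$ a \emph{binary square} if $N=0$, or if the canonical base-$2$ representation of $N$ (without leading zeroes) is of the form $yy$ for some nonempty string $y$ that starts with a $1$. A set $S \subseteq \mathbb{N}$ is an \emph{asymptotic additive basis of order $h$} if every sufficiently large natural number is the sum of $h$ members, not necessarily distinct, of $S$. The binary squares form an asymptotic additive basis of order $4$. More precisely, every natural number $N > 686$ is the sum of $4$ binary squares (not necessarily distinct). There are exactly $56$ natural numbers that are not the sum of $4$ binary squares, namely \[ \begin{aligned} &1,2,4,5,7,8,11,14,17,22,27,29,32,34,37,41,44,47,53,62,95,104,107,113,116,122,125,\\ &131,134,140,143,148,155,158,160,167,407,424,441,458,475,492,509,526,552,560,\\ &569,587,599,608,613,620,638,653,671,686. \end{aligned} \] -/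

import Mathlib

/-- The canonical base-`2` representation of `N`, most significant bit first and without leading
zeroes; the representation of `0` is the empty string. -/
def binaryRep (N : ℕ) : List ℕ := (Nat.digits 2 N).reverse

/-- `N` is a binary square if `N = 0`, or if its canonical base-`2` representation is `yy` for some
nonempty string `y` that starts with a `1`. -/
def IsBinarySquare (N : ℕ) : Prop :=
  N = 0 ∨ ∃ y : List ℕ, y.head? = some 1 ∧ binaryRep N = y ++ y

/-- `N` is the sum of `h` members, not necessarily distinct, of `S`. -/
def IsSumOf (h : ℕ) (S : Set ℕ) (N : ℕ) : Prop :=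
  ∃ f : Fin h → ℕ, (∀ i, f i ∈ S) ∧ ∑ i, f i = N

/-- `S` is an asymptotic additive basis of order `h`: every sufficiently large natural number is the
sum of `h` members, not necessarily distinct, of `S`. -/
def IsAsymptoticAdditiveBasis (h : ℕ) (S : Set ℕ) : Prop :=
  ∃ N₀ : ℕ, ∀ N : ℕ, N₀ ≤ N → IsSumOf h S N

/-- The explicit list of exceptions. -/
def exceptionsList : Finset ℕ :=
  {1, 2, 4, 5, 7, 8, 11, 14, 17, 22, 27, 29, 32, 34, 37, 41, 44, 47, 53, 62, 95, 104, 107, 113,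
   116, 122, 125, 131, 134, 140, 143, 148, 155, 158, 160, 167, 407, 424, 441, 458, 475, 492, 509,
   526, 552, 560, 569, 587, 599, 608, 613, 620, 638, 653, 671, 686}

/-! A nonzero binary square is `a * (2 ^ (m + 1) + 1)` with `a` of exactly `m + 1` bits. For three
suitable fixed half-lengths, reducing modulo the largest multiplier turns the equation into covering
all residues by the two smaller terms; the size of `N` then forces the third coefficient into range.
So three squares fill long intervals (`exists_repr_eight_four_one`,
`exists_repr_thirtytwo_four_one`), and a fourth, chosen from three values, bridges the gaps between
scales (`isSumOf_four_of_scale`). Smaller `N` are checked by the kernel, with sets of naturals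
encoded as bits and sumsets as shifts. -/

theorem isBinarySquare_of_mul {m a : ℕ} (h1 : 2 ^ m ≤ a) (h2 : a < 2 ^ (m + 1)) :
    IsBinarySquare (a * (2 ^ (m + 1) + 1)) := by
  have ha : a ≠ 0 := by have := Nat.two_pow_pos m; omega
  have hlen : (Nat.digits 2 a).length = m + 1 := by
    rw [Nat.length_digits 2 a (by norm_num) ha, Nat.log_eq_of_pow_le_of_lt_pow h1 h2]
  right
  refine ⟨(Nat.digits 2 a).reverse, ?_, ?_⟩
  · have hne : Nat.digits 2 a ≠ [] := Nat.digits_ne_nil_iff_ne_zero.mpr ha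
    rw [List.head?_reverse, List.getLast?_eq_some_getLast hne]
    have h0 := Nat.getLast_digit_ne_zero 2 ha
    have hlt : (Nat.digits 2 a).getLast hne < 2 :=
      Nat.digits_lt_base (by norm_num) (List.getLast_mem hne)
    congr 1
    omega
  · rw [binaryRep, ← List.reverse_append, Nat.digits_append_digits (by norm_num), hlen]
    congr 2
    ring

theorem IsBinarySquare.exists_mul {N : ℕ} (h : IsBinarySquare N) (hN : N ≠ 0) :
    ∃ m a, 2 ^ m ≤ a ∧ a < 2 ^ (m + 1) ∧ N = a * (2 ^ (m + 1) + 1) := by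
  obtain h | ⟨y, hy, hr⟩ := h
  · exact absurd h hN
  obtain ⟨ys, rfl⟩ : ∃ ys, y = 1 :: ys := by
    cases y with
    | nil => simp at hy
    | cons z zs => simp at hy; exact ⟨zs, by rw [hy]⟩
  set z := (1 :: ys).reverse with hz
  have hdig : Nat.digits 2 N = z ++ z := by
    rw [← List.reverse_reverse (Nat.digits 2 N)]
    rw [binaryRep] at hr
    rw [hr, List.reverse_append]
  have hdz : Nat.digits 2 (Nat.ofDigits 2 z) = z := by
    apply Nat.digits_ofDigits 2 (by norm_num)
    · intro l hl
      apply Nat.digits_lt_base (b := 2) (m := N) (by norm_num)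
      rw [hdig]
      exact List.mem_append_left _ hl
    · intro h
      simp [hz]
  have hlen : z.length = ys.length + 1 := by simp [hz]
  have ha : Nat.ofDigits 2 z ≠ 0 := by
    intro h0
    rw [h0] at hdz
    simp [hz] at hdz
  have hlog : Nat.log 2 (Nat.ofDigits 2 z) = ys.length := by
    have := Nat.length_digits 2 (Nat.ofDigits 2 z) (by norm_num) ha
    rw [hdz] at this
    omega
  refine ⟨ys.length, Nat.ofDigits 2 z, ?_, ?_, ?_⟩
  · rw [← hlog]; exact Nat.pow_log_le_self 2 ha
  · rw [← hlog]; exact Nat.lt_pow_succ_log_self (by norm_num) _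
  · rw [← Nat.ofDigits_digits 2 N, hdig, Nat.ofDigits_append, hlen]
    ring

theorem isSumOf_zero (S : Set ℕ) : IsSumOf 0 S 0 := ⟨Fin.elim0, fun i => i.elim0, by simp⟩

theorem isSumOf_succ_iff {h : ℕ} {S : Set ℕ} {N : ℕ} :
    IsSumOf (h + 1) S N ↔ ∃ s ∈ S, ∃ n, IsSumOf h S n ∧ n + s = N := by
  constructor
  · rintro ⟨f, hf, rfl⟩
    exact ⟨f 0, hf 0, _, ⟨fun i => f i.succ, fun i => hf _, rfl⟩, by
      rw [Fin.sum_univ_succ, add_comm]⟩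
  · rintro ⟨s, hs, n, ⟨f, hf, rfl⟩, rfl⟩
    refine ⟨Fin.cons s f, fun i => ?_, ?_⟩
    · cases i using Fin.cases with
      | zero => simpa using hs
      | succ i => simpa using hf i
    · rw [Fin.sum_univ_succ, add_comm]; simp

theorem IsSumOf.add {h : ℕ} {S : Set ℕ} {n s : ℕ} (hn : IsSumOf h S n) (hs : s ∈ S) :
    IsSumOf (h + 1) S (n + s) := isSumOf_succ_iff.mpr ⟨s, hs, n, hn, rfl⟩

/-! ### Finite verification with bit masks -/

/-- The union of the translates by the members of `T` of the set encoded by the bits of `M`. -/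
def shiftUnion (M : ℕ) : List ℕ → ℕ
  | [] => 0
  | t :: T => shiftUnion M T ||| M <<< t

theorem testBit_shiftUnion {M n : ℕ} {T : List ℕ} :
    (shiftUnion M T).testBit n = true ↔ ∃ t ∈ T, t ≤ n ∧ M.testBit (n - t) = true := by
  induction T with
  | nil => simp [shiftUnion]
  | cons t T ih => simp [shiftUnion, Nat.testBit_or, ih, Nat.testBit_shiftLeft, or_comm]

/-- The bits of this number are the multiples `j * s` with `j < 2 ^ n`. -/
def progressionMask (s : ℕ) : ℕ → ℕ
  | 0 => 1
  | n + 1 => progressionMask s n ||| progressionMask s n <<< (2 ^ n * s)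

theorem exists_of_testBit_progressionMask {s n i : ℕ}
    (h : (progressionMask s n).testBit i = true) : ∃ j < 2 ^ n, i = j * s := by
  induction n generalizing i with
  | zero =>
    rw [progressionMask, Nat.testBit_one_eq_true_iff_self_eq_zero] at h
    exact ⟨0, by simp, by simp [h]⟩
  | succ n ih =>
    simp only [progressionMask, Nat.testBit_or, Nat.testBit_shiftLeft, Bool.or_eq_true,
      Bool.and_eq_true, decide_eq_true_eq] at h
    obtain h | ⟨hle, h⟩ := h
    · obtain ⟨j, hj, rfl⟩ := ih h
      exact ⟨j, by rw [pow_succ]; omega, rfl⟩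
    · obtain ⟨j, hj, hij⟩ := ih h
      exact ⟨2 ^ n + j, by rw [pow_succ]; omega, by rw [add_mul]; omega⟩

/-- Encodes the binary squares whose representation has length at most `2 * n`. -/
def squareMask : ℕ → ℕ
  | 0 => 1
  | n + 1 => squareMask n ||| progressionMask (2 ^ (n + 1) + 1) n <<< (2 ^ n * (2 ^ (n + 1) + 1))

theorem isBinarySquare_of_testBit_squareMask {n i : ℕ} (h : (squareMask n).testBit i = true) :
    IsBinarySquare i := by
  induction n with
  | zero =>
    rw [squareMask, Nat.testBit_one_eq_true_iff_self_eq_zero] at h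
    exact Or.inl h
  | succ n ih =>
    simp only [squareMask, Nat.testBit_or, Nat.testBit_shiftLeft, Bool.or_eq_true,
      Bool.and_eq_true, decide_eq_true_eq] at h
    obtain h | ⟨hle, h⟩ := h
    · exact ih h
    · obtain ⟨j, hj, hij⟩ := exists_of_testBit_progressionMask h
      have : i = (2 ^ n + j) * (2 ^ (n + 1) + 1) := by rw [add_mul]; omega
      rw [this]
      exact isBinarySquare_of_mul (by omega) (by rw [pow_succ]; omega)

/-- For each half-length up to `n`, at most `32` equally spaced binary squares; also `0`. -/
def squareSample (n : ℕ) : List ℕ :=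
  0 :: (List.range n).flatMap fun m => (List.range (2 ^ min m 5)).map fun i =>
    (2 ^ m + i * 2 ^ (m - min m 5)) * (2 ^ (m + 1) + 1)

theorem isBinarySquare_of_mem_squareSample {n t : ℕ} (h : t ∈ squareSample n) :
    IsBinarySquare t := by
  simp only [squareSample, List.mem_cons, List.mem_flatMap, List.mem_map, List.mem_range] at h
  obtain rfl | ⟨m, -, i, hi, rfl⟩ := h
  · exact Or.inl rfl
  · refine isBinarySquare_of_mul (by omega) ?_
    have h1 : i * 2 ^ (m - min m 5) < 2 ^ min m 5 * 2 ^ (m - min m 5) :=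
      Nat.mul_lt_mul_of_pos_right hi (Nat.two_pow_pos _)
    rw [← pow_add, show min m 5 + (m - min m 5) = m by omega] at h1
    rw [pow_succ]
    omega

/-- Up to half-length 5 the sample omits nothing, and `2080 = 32 * 65` is the least binary square of
half-length 6. -/
theorem mem_squareSample_of_lt {t : ℕ} (h : IsBinarySquare t) (ht : t < 2080) :
    t ∈ squareSample 5 := by
  obtain rfl | h0 := eq_or_ne t 0
  · simp [squareSample]
  obtain ⟨m, a, h1, h2, rfl⟩ := h.exists_mul h0
  have hm : m < 5 := by
    by_contra! hm
    have h5 : 2 ^ 5 ≤ 2 ^ m := Nat.pow_le_pow_right (by norm_num) hm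
    rw [pow_succ] at ht
    nlinarith
  simp only [squareSample, List.mem_cons, List.mem_flatMap, List.mem_map, List.mem_range]
  refine Or.inr ⟨m, hm, a - 2 ^ m, ?_, ?_⟩
  · rw [min_eq_left hm.le]; rw [pow_succ] at h2; omega
  · rw [min_eq_left hm.le, Nat.sub_self, pow_zero, mul_one, Nat.add_sub_cancel' h1]

theorem isSumOf_of_testBit_shiftUnion {h n M : ℕ} {T : List ℕ} {S : Set ℕ}
    (hM : ∀ i, M.testBit i = true → IsSumOf h S i) (hT : ∀ t ∈ T, t ∈ S)
    (hn : (shiftUnion M T).testBit n = true) : IsSumOf (h + 1) S n := by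
  obtain ⟨t, ht, hle, hb⟩ := testBit_shiftUnion.mp hn
  have := (hM _ hb).add (hT t ht)
  rwa [Nat.sub_add_cancel hle] at this

theorem isSumOf_of_testBit_mod {h n M : ℕ} {T : List ℕ} {S : Set ℕ} {L : ℕ}
    (hM : ∀ i, M.testBit i = true → IsSumOf h S i) (hT : ∀ t ∈ T, t ∈ S)
    (hn : (shiftUnion M T % 2 ^ L).testBit n = true) : IsSumOf (h + 1) S n := by
  rw [Nat.testBit_mod_two_pow, Bool.and_eq_true] at hn
  exact isSumOf_of_testBit_shiftUnion hM hT hn.2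

/-- Encodes sums below `L` of a binary square and three members of `squareSample 10`. -/
def sampledSums (L : ℕ) : ℕ :=
  shiftUnion (shiftUnion (shiftUnion (squareMask 11 % 2 ^ L) (squareSample 10) % 2 ^ L)
    (squareSample 10) % 2 ^ L) (squareSample 10) % 2 ^ L

theorem isSumOf_four_of_testBit_sampledSums {L N : ℕ} (h : (sampledSums L).testBit N = true) :
    IsSumOf 4 {n : ℕ | IsBinarySquare n} N := by
  have hT : ∀ t ∈ squareSample 10, t ∈ {n : ℕ | IsBinarySquare n} :=
    fun t ht => isBinarySquare_of_mem_squareSample ht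
  refine isSumOf_of_testBit_mod (fun _ => isSumOf_of_testBit_mod (fun _ =>
    isSumOf_of_testBit_mod (fun i hi => ?_) hT) hT) hT h
  rw [Nat.testBit_mod_two_pow, Bool.and_eq_true] at hi
  simpa using (isSumOf_zero _).add (S := {n : ℕ | IsBinarySquare n})
    (isBinarySquare_of_testBit_squareMask hi.2)

theorem isSumOf_four_of_sampledSums_eq {L N : ℕ}
    (h : (2 ^ 687 - 1) ||| sampledSums L = 2 ^ L - 1) (h1 : 686 < N) (h2 : N < L) :
    IsSumOf 4 {n : ℕ | IsBinarySquare n} N := by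
  replace h := congrArg (fun M => M.testBit N) h
  simp only [Nat.testBit_or, Nat.testBit_two_pow_sub_one, h2, decide_true, Bool.or_eq_true,
    decide_eq_true_eq] at h
  exact isSumOf_four_of_testBit_sampledSums (h.resolve_left (by omega))

/-- The bound is `529 * 64 ^ 2`, where the scale argument takes over. Sampling keeps the number of
shifts small. -/
theorem sampledSums_eq : (2 ^ 687 - 1) ||| sampledSums 2166784 = 2 ^ 2166784 - 1 := by
  decide +kernel

/-- The number whose bits are the sums of `h` members of `squareSample 5`. -/
def smallSums : ℕ → ℕ
  | 0 => 1
  | h + 1 => shiftUnion (smallSums h) (squareSample 5)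

theorem testBit_smallSums_iff {h n : ℕ} (hn : n < 2080) :
    (smallSums h).testBit n = true ↔ IsSumOf h {n : ℕ | IsBinarySquare n} n := by
  induction h generalizing n with
  | zero =>
    rw [smallSums, Nat.testBit_one_eq_true_iff_self_eq_zero]
    constructor
    · rintro rfl; exact isSumOf_zero _
    · rintro ⟨f, -, rfl⟩; simp
  | succ h ih =>
    rw [smallSums, testBit_shiftUnion, isSumOf_succ_iff]
    constructor
    · rintro ⟨t, ht, hle, hb⟩
      exact ⟨t, isBinarySquare_of_mem_squareSample ht, n - t, (ih (by omega)).mp hb, by omega⟩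
    · rintro ⟨s, hs, k, hk, rfl⟩
      refine ⟨s, mem_squareSample_of_lt hs (by omega), by omega, ?_⟩
      rw [Nat.add_sub_cancel]
      exact (ih (by omega)).mpr hk

theorem testBit_smallSums_four :
    ∀ n < 687, (smallSums 4).testBit n = false ↔ n ∈ exceptionsList := by
  decide +kernel

/-! ### Sums of three binary squares in long intervals -/

theorem isSumOf_three_of_mul {m n k a b c N : ℕ} (ha : 2 ^ m ≤ a ∧ a < 2 ^ (m + 1))
    (hb : 2 ^ n ≤ b ∧ b < 2 ^ (n + 1)) (hc : 2 ^ k ≤ c ∧ c < 2 ^ (k + 1))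
    (h : a * (2 ^ (m + 1) + 1) + b * (2 ^ (n + 1) + 1) + c * (2 ^ (k + 1) + 1) = N) :
    IsSumOf 3 {n : ℕ | IsBinarySquare n} N := by
  have h0 := (isSumOf_zero {n : ℕ | IsBinarySquare n}).add (isBinarySquare_of_mul ha.1 ha.2)
  have h1 := (h0.add (isBinarySquare_of_mul hb.1 hb.2)).add (isBinarySquare_of_mul hc.1 hc.2)
  rw [← h, ← zero_add (a * (2 ^ (m + 1) + 1))]
  exact h1

/-- With the other two terms at their extremes, `N` still leaves no room for `a` outside its range.
-/
theorem mem_Ico_of_mul_add_eq {A B C a b c N : ℤ} (hA : 0 < A) (hB : 0 < B) (hC : 0 < C)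
    (hb : B ≤ b ∧ b < 2 * B) (hc : C ≤ c ∧ c < 2 * C)
    (h1 : (A - 1) * (2 * A + 1) + (2 * B - 1) * (2 * B + 1) + (2 * C - 1) * (2 * C + 1) < N)
    (h2 : N < 2 * A * (2 * A + 1) + B * (2 * B + 1) + C * (2 * C + 1))
    (h : a * (2 * A + 1) + b * (2 * B + 1) + c * (2 * C + 1) = N) : A ≤ a ∧ a < 2 * A := by
  have hb1 : B * (2 * B + 1) ≤ b * (2 * B + 1) := by gcongr; exact hb.1
  have hb2 : b * (2 * B + 1) ≤ (2 * B - 1) * (2 * B + 1) := by gcongr; omega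
  have hc1 : C * (2 * C + 1) ≤ c * (2 * C + 1) := by gcongr; exact hc.1
  have hc2 : c * (2 * C + 1) ≤ (2 * C - 1) * (2 * C + 1) := by gcongr; omega
  constructor
  · have : (A - 1) * (2 * A + 1) < a * (2 * A + 1) := by linarith
    have := lt_of_mul_lt_mul_right this (by omega)
    omega
  · have : a * (2 * A + 1) < 2 * A * (2 * A + 1) := by linarith
    exact lt_of_mul_lt_mul_right this (by omega)

/-- Here the auxiliary variable `d` stands for `2 * a + b`. -/
theorem exists_repr_eight_four_one {J N : ℤ} (hJ : 32 ≤ J) (h1 : 49 * (2 * J) ^ 2 ≤ N)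
    (h2 : N ≤ 72 * (2 * J) ^ 2) :
    ∃ a b c : ℤ, (8 * J ≤ a ∧ a < 2 * (8 * J)) ∧ (4 * J ≤ b ∧ b < 2 * (4 * J)) ∧
      (J ≤ c ∧ c < 2 * J) ∧
      a * (2 * (8 * J) + 1) + b * (2 * (4 * J) + 1) + c * (2 * J + 1) = N := by
  obtain ⟨d, b, c, hb, hc, he⟩ : ∃ d b c : ℤ, (4 * J ≤ b ∧ b < 2 * (4 * J)) ∧
      (J ≤ c ∧ c < 2 * J) ∧ 2 * N = d * (16 * J + 1) + b + 2 * (c * (2 * J + 1)) := by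
    -- Modulo `16 * J + 1`, `b` covers `4 * J` consecutive residues and raising `c` by 1 shifts them
    -- by `4 * J + 2`, missing two per step. Raising `c` by 4 shifts by 7, which fills these gaps.
    set u := 2 * N - 2 * ((2 * J - 8) * (2 * J + 1)) - 4 * J with hu
    have hr0 := Int.emod_nonneg u (show 16 * J + 1 ≠ 0 by omega)
    have hr1 := Int.emod_lt_of_pos u (show 0 < 16 * J + 1 by omega)
    have hr := Int.mul_ediv_add_emod u (16 * J + 1)
    set r := u % (16 * J + 1)
    set d := u / (16 * J + 1)
    have hs0 := Int.emod_nonneg r (show 4 * J + 2 ≠ 0 by omega)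
    have hs1 := Int.emod_lt_of_pos r (show 0 < 4 * J + 2 by omega)
    have hs := Int.mul_ediv_add_emod r (4 * J + 2)
    have hi0 : 0 ≤ r / (4 * J + 2) := Int.ediv_nonneg hr0 (by omega)
    have hi1 : r / (4 * J + 2) < 4 := Int.ediv_lt_of_lt_mul (by omega) (by omega)
    set s := r % (4 * J + 2)
    set i := r / (4 * J + 2)
    by_cases hsJ : s < 4 * J
    · exact ⟨d, s + 4 * J, 2 * J - 8 + i, by omega, by omega, by
        linear_combination (-1) * hr - hs + hu⟩
    · exact ⟨d - 1, s - 7 + 4 * J, 2 * J - 8 + (i + 4), by omega, by omega, by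
        linear_combination (-1) * hr - hs + hu⟩
  obtain ⟨a, rfl⟩ : ∃ a, d = 2 * a + b :=
    ⟨N - 8 * J * d - b - c * (2 * J + 1), by linear_combination (-1) * he⟩
  have h : a * (2 * (8 * J) + 1) + b * (2 * (4 * J) + 1) + c * (2 * J + 1) = N := by
    linarith
  refine ⟨a, b, c, mem_Ico_of_mul_add_eq (by omega) (by omega) (by omega) hb hc ?_ ?_ h,
    hb, hc, h⟩ <;> nlinarith

/-- Here the auxiliary variable `e` stands for `8 * a + b`. -/
theorem exists_repr_thirtytwo_four_one {J N : ℤ} (hJ : 32 ≤ J) (h1 : 529 * (2 * J) ^ 2 ≤ N)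
    (h2 : N ≤ 1032 * (2 * J) ^ 2) :
    ∃ a b c : ℤ, (32 * J ≤ a ∧ a < 2 * (32 * J)) ∧ (4 * J ≤ b ∧ b < 2 * (4 * J)) ∧
      (J ≤ c ∧ c < 2 * J) ∧
      a * (2 * (32 * J) + 1) + b * (2 * (4 * J) + 1) + c * (2 * J + 1) = N := by
  obtain ⟨e, b, c, hb, hc, he⟩ : ∃ e b c : ℤ, (4 * J ≤ b ∧ b < 2 * (4 * J)) ∧
      (J ≤ c ∧ c < 2 * J) ∧ 8 * N = e * (64 * J + 1) + 7 * b + 8 * (c * (2 * J + 1)) := by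
    set u := 8 * N - 8 * ((2 * J - 4) * (2 * J + 1)) - 28 * J with hu
    have hr0 := Int.emod_nonneg u (show 64 * J + 1 ≠ 0 by omega)
    have hr1 := Int.emod_lt_of_pos u (show 0 < 64 * J + 1 by omega)
    have hr := Int.mul_ediv_add_emod u (64 * J + 1)
    set r := u % (64 * J + 1)
    set e := u / (64 * J + 1)
    have hs0 := Int.emod_nonneg r (show 16 * J + 8 ≠ 0 by omega)
    have hs1 := Int.emod_lt_of_pos r (show 0 < 16 * J + 8 by omega)
    have hs := Int.mul_ediv_add_emod r (16 * J + 8)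
    have hi0 : 0 ≤ r / (16 * J + 8) := Int.ediv_nonneg hr0 (by omega)
    have hi1 : r / (16 * J + 8) < 4 := Int.ediv_lt_of_lt_mul (by omega) (by omega)
    set s := r % (16 * J + 8)
    set i := r / (16 * J + 8)
    -- Lowering `c` by 4 changes the residue by `-31` modulo `64 * J + 1`, so `j` such moves make
    -- the remainder divisible by 7; `j = 2 * s % 7` works since `1 + 31 * 2 = 63`.
    obtain ⟨j, t, hj0, hj1, hjt⟩ : ∃ j t : ℤ, 0 ≤ j ∧ j < 7 ∧ s + 31 * j = 7 * t :=
      ⟨2 * s % 7, (s + 31 * (2 * s % 7)) / 7, by omega, by omega, by omega⟩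
    exact ⟨e + j, 4 * J + t, 2 * J - 4 + i - 4 * j, by omega, by omega, by
      linear_combination (-1) * hr - hs + hu + hjt⟩
  obtain ⟨a, rfl⟩ : ∃ a, e = 8 * a + b :=
    ⟨N - 8 * J * e - b - c * (2 * J + 1), by linear_combination (-1) * he⟩
  have h : a * (2 * (32 * J) + 1) + b * (2 * (4 * J) + 1) + c * (2 * J + 1) = N := by
    linarith
  refine ⟨a, b, c, mem_Ico_of_mul_add_eq (by omega) (by omega) (by omega) hb hc ?_ ?_ h,
    hb, hc, h⟩ <;> nlinarith

theorem isSumOf_three_of_le {k N : ℕ} (hk : 5 ≤ k) (h1 : 49 * (2 ^ (k + 1)) ^ 2 ≤ N)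
    (h2 : N ≤ 72 * (2 ^ (k + 1)) ^ 2) : IsSumOf 3 {n : ℕ | IsBinarySquare n} N := by
  have hk' : 2 ^ 5 ≤ 2 ^ k := Nat.pow_le_pow_right (by norm_num) hk
  rw [pow_succ' 2 k] at h1 h2
  obtain ⟨a, b, c, ha, hb, hc, h⟩ := exists_repr_eight_four_one (J := ((2 ^ k : ℕ) : ℤ)) (N := N)
    (by exact_mod_cast hk') (by exact_mod_cast h1) (by exact_mod_cast h2)
  lift a to ℕ using by omega
  lift b to ℕ using by omega
  lift c to ℕ using by omega
  refine isSumOf_three_of_mul (m := k + 3) (n := k + 2) (k := k) (a := a) (b := b) (c := c)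
    ?_ ?_ ?_ ?_
  · simp only [pow_succ]; omega
  · simp only [pow_succ]; omega
  · simp only [pow_succ]; omega
  · zify; rw [← h]; push_cast; ring

theorem isSumOf_three_of_le' {k N : ℕ} (hk : 5 ≤ k) (h1 : 529 * (2 ^ (k + 1)) ^ 2 ≤ N)
    (h2 : N ≤ 1032 * (2 ^ (k + 1)) ^ 2) : IsSumOf 3 {n : ℕ | IsBinarySquare n} N := by
  have hk' : 2 ^ 5 ≤ 2 ^ k := Nat.pow_le_pow_right (by norm_num) hk
  rw [pow_succ' 2 k] at h1 h2
  obtain ⟨a, b, c, ha, hb, hc, h⟩ := exists_repr_thirtytwo_four_one (J := ((2 ^ k : ℕ) : ℤ))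
    (N := N) (by exact_mod_cast hk') (by exact_mod_cast h1) (by exact_mod_cast h2)
  lift a to ℕ using by omega
  lift b to ℕ using by omega
  lift c to ℕ using by omega
  refine isSumOf_three_of_mul (m := k + 5) (n := k + 2) (k := k) (a := a) (b := b) (c := c)
    ?_ ?_ ?_ ?_
  · simp only [pow_succ]; omega
  · simp only [pow_succ]; omega
  · simp only [pow_succ]; omega
  · zify; rw [← h]; push_cast; ring

/-! ### Four binary squares at every scale -/

theorem isSumOf_four_of_scale {k N : ℕ} (hk : 5 ≤ k) (h1 : 529 * (2 ^ (k + 1)) ^ 2 ≤ N)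
    (h2 : N < 529 * (2 ^ (k + 2)) ^ 2) : IsSumOf 4 {n : ℕ | IsBinarySquare n} N := by
  have hK : 2 ^ 6 ≤ 2 ^ (k + 1) := Nat.pow_le_pow_right (by norm_num) (by omega)
  have hK2 : 64 * 2 ^ (k + 1) ≤ (2 ^ (k + 1)) ^ 2 := by nlinarith
  have e1 : 2 ^ (k + 2 + 1) = 4 * 2 ^ (k + 1) := by ring
  have e2 : 2 ^ (k + 2) = 2 * 2 ^ (k + 1) := by ring
  have e3 : 2 ^ (k + 5) = 16 * 2 ^ (k + 1) := by ring
  have e4 : 2 ^ (k + 5 + 1) = 32 * 2 ^ (k + 1) := by ring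
  -- The second interval is `[49, 72]` scaled by 16; the two overlap, so together they cover `[529,
  -- 1152]` times the square.
  have three : ∀ n, (529 * (2 ^ (k + 1)) ^ 2 ≤ n ∧ n ≤ 1032 * (2 ^ (k + 1)) ^ 2) ∨
      (784 * (2 ^ (k + 1)) ^ 2 ≤ n ∧ n ≤ 1152 * (2 ^ (k + 1)) ^ 2) →
      IsSumOf 3 {n : ℕ | IsBinarySquare n} n := by
    rintro n (h | h)
    · exact isSumOf_three_of_le' hk h.1 h.2
    · refine isSumOf_three_of_le (k := k + 2) (by omega) ?_ ?_ <;> rw [e1, mul_pow] <;> omega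
  have add_sub : ∀ y, IsBinarySquare y → y ≤ N → IsSumOf 3 {n : ℕ | IsBinarySquare n} (N - y) →
      IsSumOf 4 {n : ℕ | IsBinarySquare n} N := by
    intro y hy hle h
    have := h.add (s := y) hy
    rwa [Nat.sub_add_cancel hle] at this
  -- `y0` and `y1` are the least and greatest binary squares of half-length `k + 6`.
  have y0 : IsBinarySquare (512 * (2 ^ (k + 1)) ^ 2 + 16 * 2 ^ (k + 1)) := by
    have := isBinarySquare_of_mul (m := k + 5) (a := 2 ^ (k + 5)) le_rfl (by omega)
    rw [e3, e4] at this
    convert this using 1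
    ring
  have y1 : IsBinarySquare (1024 * (2 ^ (k + 1)) ^ 2 - 1) := by
    have := isBinarySquare_of_mul (m := k + 5) (a := 2 ^ (k + 5 + 1) - 1) (by omega) (by omega)
    rw [e4] at this
    convert this using 1
    rw [mul_comm (_ - 1), ← Nat.sq_sub_sq, mul_pow, one_pow]
    norm_num
  rw [e2, mul_pow] at h2
  generalize 2 ^ (k + 1) = K at *
  generalize K ^ 2 = Q at *
  by_cases c0 : N ≤ 1032 * Q ∨ 784 * Q ≤ N ∧ N ≤ 1152 * Q
  · exact add_sub 0 (Or.inl rfl) (by omega) (three _ (by omega))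
  by_cases c1 : N ≤ 1664 * Q
  · exact add_sub _ y0 (by omega) (three _ (by omega))
  · exact add_sub _ y1 (by omega) (three _ (by omega))

theorem isSumOf_four_of_gt {N : ℕ} (hN : 686 < N) : IsSumOf 4 {n : ℕ | IsBinarySquare n} N := by
  by_cases h : N < 2166784
  · exact isSumOf_four_of_sampledSums_eq sampledSums_eq hN h
  have hk : ∀ k, N < 529 * (2 ^ (k + 6)) ^ 2 → IsSumOf 4 {n : ℕ | IsBinarySquare n} N := by
    intro k hk
    induction k with
    -- Vacuous, since `529 * 64 ^ 2 = 2166784 ≤ N`.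
    | zero => omega
    | succ k ih =>
      by_cases hk' : N < 529 * (2 ^ (k + 6)) ^ 2
      · exact ih hk'
      · exact isSumOf_four_of_scale (k := k + 5) (by omega) (not_lt.mp hk') hk
  apply hk N
  have h1 : N < 2 ^ (N + 6) :=
    Nat.lt_two_pow_self.trans (Nat.pow_lt_pow_right (by norm_num) (by omega))
  nlinarith

theorem theorem1 :
    IsAsymptoticAdditiveBasis 4 {n : ℕ | IsBinarySquare n} ∧
    (∀ N : ℕ, 686 < N → IsSumOf 4 {n : ℕ | IsBinarySquare n} N) ∧
    {N : ℕ | ¬ IsSumOf 4 {n : ℕ | IsBinarySquare n} N} = (exceptionsList : Set ℕ) ∧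
    {N : ℕ | ¬ IsSumOf 4 {n : ℕ | IsBinarySquare n} N}.ncard = 56 := by
  have hset : {N : ℕ | ¬ IsSumOf 4 {n : ℕ | IsBinarySquare n} N} = (exceptionsList : Set ℕ) := by
    ext N
    rw [Set.mem_ofPred_eq, Finset.mem_coe]
    by_cases hN : N < 687
    · rw [← testBit_smallSums_iff (by omega), Bool.not_eq_true]
      exact testBit_smallSums_four N hN
    · have hle : ∀ n ∈ exceptionsList, n < 687 := by decide +kernel
      exact iff_of_false (not_not.mpr (isSumOf_four_of_gt (by omega))) fun h => hN (hle N h)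
  refine ⟨⟨687, fun N hN => isSumOf_four_of_gt hN⟩, fun N => isSumOf_four_of_gt, hset, ?_⟩
  rw [hset, Set.ncard_coe_finset]
  decide +kernel
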